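/- **Setting.** Let $M$ be a compact $d$-dimensional Riemannian manifold, $V$ a smooth vector field on $M$, $\Phi\colon M\to N$ a $C^\infty$-diffeomorphism onto a smooth manifold $N$, and $T>0$. For $E=M,N$ let $C([0,T),E)$ carry the coordinate process and the filtration $\mathcal F_t=\sigma(X_s: s\le t)$, $t\in[0,T)$, and put $\mathcal F_T=\sigma(X_s:s<T)$. Consider a law $P$ on $C([0,T),E)$ of a continuous time-homogeneous Markov process $X$ started at a point $x_0$, with transition kernels $(\kappa_t)_{t\ge0}$, write $\mathbb E(\varphi(X_t)\mid X_s=x)=\int\varphi\,d\kappa_{t-s}(x,\cdot)$, let $\mathcal L\varphi(x)=\lim_{t\downarrow0}t^{-1}\big(\mathbb E(\varphi(X_t)\mid X_0=x)-\varphi(x)\big)$ be its generator and $\mathcal A=\partial_t+\mathcal L$. Let $\mathcal H$ be the set of measurable $f\colon[0,T)\times E\to(0,\infty)$ in the domain of $\mathcal A$ such that, for all $t<T$, $\int_0^t|\mathcal Af/f|(s,X_s)\,ds<\infty$ $P$-a.s., and such that $$E^f_t(X)=\frac{f(t,X_t)}{f(0,X_0)}\exp\Big(-\int_0^t\frac{\mathcal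 Af}{f}(s,X_s)\,ds\Big),\qquad t\in[0,T),$$ is a martingale. For $f\in\mathcal H$ let $P^f_T$ be the probability measure on $\mathcal F_T$ with $dP^f_T/dP=E^f_t(X)$ on $\mathcal F_t$ for every $t<T$; $\mathbb E^f$ is the corresponding expectation. Put $\Psi_{t,f}(X)=\exp\big(\int_0^t\frac{\mathcal Af}{f}(s,X_s)\,ds\big)$ for $t\le T$. **Conditions** for $X$ with $g$ and $h$: $g,h\in\mathcal H$, $\mathcal Ah=0$ on $[0,T)\times E$, and there are $t_0\in[0,T)$ and events $A^t_k\in\mathcal F_t$ ($k\in\mathbb N$, $t\in[t_0,T)$) such that * (a) $A^t_k\subseteq A^t_{k+1}$ and $A^t_k\subseteq A^s_k$ for all $k$ and $t_0\le s\le t<T$; put $A^t=\bigcup_kA^t_k$ and $A^T=\bigcap_{t_0\le t<T}A^t$; * (b) for every $s\in[t_0,T)$ there is a constant $C_s$ such that, for all $t\in[s,T)$, $g(t,X_t)$ is $P$-integrable and $\mathbb E(g(t,X_t)\mid\mathcal F_s)\le C_s$ $P$-a.s.; and $\lim_{t\uparrow T}\mathbb E(g(t,X_t)\mid X_s=x)=h(s,x)$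 for all $s\in[t_0,T)$, $x\in E$; * (c) $\lim_{k\to\infty}\lim_{t\uparrow T}\mathbb E^h\big(\tfrac{g(t,X_t)}{h(t,X_t)}\mathbf 1_{A^t_k}\big)=1$; * (d) for every $k$ there is a constant $C_k$ such that, for all $t\in[t_0,T)$, $\Psi_{t,g}(X)\mathbf 1_{A^t_k}\le C_k$ $P^g$-a.s.; and $\int_0^T|\mathcal Ag/g|(s,X_s)\,ds<\infty$ $P^g$-a.s., so that $\Psi_{T,g}(X)$ is well defined; * (e) $P^g(A^T)=1$. **Theorem.** Let $X$ be Brownian motion with drift $V$ on $M$ started at $x_0$, that is, the diffusion whose generator is $\mathcal L\varphi=V\varphi+\frac12\Delta\varphi$ for $\varphi\in C^2(M)$, where $\Delta$ is the Laplace–Beltrami operator (and the limit is uniform). Let $Y=\Phi(X)$, with law $Q$ and starting point $y_0=\Phi(x_0)$, and let $(\Phi_*f)(t,y)=f(t,\Phi^{-1}(y))$. Suppose the conditions hold for $X$ with $g$ and $h$, with $t_0$ and events $A_k^t$. Then $Y$ is a Markov process with transition kernels $\kappa^Y_t(y,B)=\kappa_t(\Phi^{-1}(y),\Phi^{-1}(B))$,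 and the conditions hold for $Y$ with $\Phi_*g$ and $\Phi_*h$, with the same $t_0$ and the corresponding events $\{\Phi^{-1}(Y)\in A^t_k\}$. Moreover $Q^{\Phi_*h}_T$ and $Q^{\Phi_*g}_T$ are equivalent, with $$\frac{dQ^{\Phi_*h}_T}{dQ^{\Phi_*g}_T}(Y)=\frac{\Phi_*g(0,y_0)}{\Phi_*h(0,y_0)}\,\Psi_{T,g}(\Phi^{-1}(Y)),\qquad \Psi_{T,g}(X)=\exp\Big(\int_0^T\frac{\mathcal Ag}{g}(s,X_s)\,ds\Big),$$ where $\mathcal A$ is the space-time generator of $X$. If $g(t,\cdot)\in C^2(M)$ and $\partial_tg+\frac12\Delta g=0$ on $[0,T)\times M$ (for instance if $g(t,x)$ is the heat kernel of $M$ at time $T-t$ between $x$ and a fixed point), then $\mathcal Ag/g=V(\log g)$, so that $\Psi_{T,g}(X)=\exp\big(\int_0^TV(\log g)(s,X_s)\,ds\big)$. -/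

import Mathlib

open MeasureTheory ProbabilityTheory Filter Topology Set
open scoped Manifold ContDiff NNReal ENNReal

noncomputable section

namespace GuidedProcess

/-! ### Path space and its filtration -/

section Path

/-- Continuous paths `[0, T) → E`; the process `X` is the coordinate process `X_t(w) = w t`. -/
abbrev PathSpace (T : ℝ) (E : Type*) [TopologicalSpace E] := C(Set.Ico (0 : ℝ) T, E)

variable {T : ℝ} {E : Type*} [TopologicalSpace E] [MeasurableSpace E]

/-- The σ-algebra generated by all the coordinates `X_s`, `s < T`. -/
instance : MeasurableSpace (PathSpace T E) :=
  ⨆ s : Set.Ico (0 : ℝ) T, MeasurableSpace.comap (fun w : PathSpace T E => w s) inferInstance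

variable (T E) in
/-- The natural filtration `ℱ_t = σ(X_s : s ≤ t)`, `t ∈ [0, T)`. -/
def pathFiltration :
    Filtration (Set.Ico (0 : ℝ) T) (inferInstance : MeasurableSpace (PathSpace T E)) where
  seq t := ⨆ s : {s : Set.Ico (0 : ℝ) T // s ≤ t},
    MeasurableSpace.comap (fun w : PathSpace T E => w s.1) inferInstance
  mono' _ _ hst := iSup_le fun r => le_iSup
    (fun q : {q : Set.Ico (0 : ℝ) T // q ≤ _} =>
      MeasurableSpace.comap (fun w : PathSpace T E => w q.1) inferInstance)
    ⟨r.1, r.2.trans hst⟩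
  le' _ := iSup_le fun r => le_iSup
    (fun q : Set.Ico (0 : ℝ) T =>
      MeasurableSpace.comap (fun w : PathSpace T E => w q) inferInstance) r.1

variable (T) in
/-- The time `0` as an element of `[0, T)`. -/
def startTime [hT : Fact (0 < T)] : Set.Ico (0 : ℝ) T := ⟨0, le_rfl, hT.out⟩

variable (T) in
/-- Lebesgue measure on `[0, T)`. -/
def timeMeasure : Measure (Set.Ico (0 : ℝ) T) := Measure.comap Subtype.val volume

end Path

/-! ### Markov processes, generators and changes of measure -/

section Markov

variable {T : ℝ} {E : Type*} [TopologicalSpace E] [MeasurableSpace E]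

/-- `(κ t)_{t ≥ 0}` is a (time-homogeneous) Markov transition function on `E`. -/
structure IsTransitionSemigroup (κ : ℝ≥0 → Kernel E E) : Prop where
  isMarkov : ∀ t, IsMarkovKernel (κ t)
  zero : κ 0 = Kernel.id
  chapman_kolmogorov : ∀ s t, κ (s + t) = κ t ∘ₖ κ s

/-- The conditional expectation `𝔼(φ(X_t) ∣ X_s = x)` given by the transition function. -/
def condExpAt (κ : ℝ≥0 → Kernel E E) (φ : E → ℝ) (s t : ℝ) (x : E) : ℝ :=
  ∫ y, φ y ∂(κ (t - s).toNNReal x)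

/-- `P` is the law of a Markov process with transition function `κ` (relative to its natural
filtration), with continuous paths, started at `x₀`. -/
structure IsMarkovLaw [Fact (0 < T)] (P : Measure (PathSpace T E)) (κ : ℝ≥0 → Kernel E E)
    (x₀ : E) : Prop where
  isProbability : IsProbabilityMeasure P
  start : ∀ᵐ w ∂P, w (startTime T) = x₀
  markov : ∀ s t : Set.Ico (0 : ℝ) T, s ≤ t → ∀ B : Set E, MeasurableSet B →
    P[fun w => B.indicator (fun _ => (1 : ℝ)) (w t) | pathFiltration T E s]
      =ᵐ[P] fun w => condExpAt κ (B.indicator fun _ => (1 : ℝ)) s t (w s)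

/-- The difference quotient `(𝔼(φ(X_t) ∣ X_0 = x) - φ(x)) / t`. -/
def diffQuot (κ : ℝ≥0 → Kernel E E) (φ : E → ℝ) (t : ℝ≥0) (x : E) : ℝ :=
  ((∫ y, φ y ∂(κ t x)) - φ x) / t

/-- The domain of the infinitesimal generator. -/
def InGeneratorDomain (κ : ℝ≥0 → Kernel E E) (φ : E → ℝ) : Prop :=
  ∀ x, (∀ᶠ t in 𝓝[>] (0 : ℝ≥0), Integrable φ (κ t x)) ∧
    ∃ l : ℝ, Tendsto (fun t => diffQuot κ φ t x) (𝓝[>] (0 : ℝ≥0)) (𝓝 l)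

/-- The infinitesimal generator `ℒφ(x) = lim_{t ↓ 0} (𝔼(φ(X_t) ∣ X_0 = x) - φ(x)) / t`. -/
def generator (κ : ℝ≥0 → Kernel E E) (φ : E → ℝ) (x : E) : ℝ :=
  limUnder (𝓝[>] (0 : ℝ≥0)) (fun t => diffQuot κ φ t x)

variable (T) in
/-- The time derivative `∂_t f` on `[0, T) × E` (one-sided at `t = 0`). -/
def timeDeriv (f : ℝ → E → ℝ) (t : ℝ) (x : E) : ℝ :=
  derivWithin (fun s => f s x) (Set.Ico 0 T) t

variable (T) in
/-- The space-time generator `𝒜 = ∂_t + ℒ`. -/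
def spaceTimeGen (κ : ℝ≥0 → Kernel E E) (f : ℝ → E → ℝ) (t : ℝ) (x : E) : ℝ :=
  timeDeriv T f t x + generator κ (f t) x

variable (T) in
/-- The domain of `𝒜 = ∂_t + ℒ`, for functions on `[0, T) × E`. -/
def InSpaceTimeDomain (κ : ℝ≥0 → Kernel E E) (f : ℝ → E → ℝ) : Prop :=
  ∀ t ∈ Set.Ico 0 T, InGeneratorDomain κ (f t) ∧
    ∀ x, DifferentiableWithinAt ℝ (fun s => f s x) (Set.Ico 0 T) t

/-- `E_t^f(X) = f(t, X_t) / f(0, X_0) * exp (-∫_0^t (𝒜f / f)(s, X_s) ds)`. -/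
def expMart [Fact (0 < T)] (κ : ℝ≥0 → Kernel E E) (f : ℝ → E → ℝ)
    (t : Set.Ico (0 : ℝ) T) (w : PathSpace T E) : ℝ :=
  f t (w t) / f 0 (w (startTime T)) *
    Real.exp (-∫ s in Set.Iic t, spaceTimeGen T κ f (s : ℝ) (w s) / f (s : ℝ) (w s) ∂timeMeasure T)

/-- The class `ℋ` of positive measurable functions `f` on `[0, T) × E` in the domain of `𝒜`,
for which the process `E^f(X)` is well defined and a martingale. -/
structure MemH [Fact (0 < T)] (P : Measure (PathSpace T E)) (κ : ℝ≥0 → Kernel E E)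
    (f : ℝ → E → ℝ) : Prop where
  measurable : Measurable fun p : Set.Ico (0 : ℝ) T × E => f (p.1 : ℝ) p.2
  pos : ∀ t ∈ Set.Ico 0 T, ∀ x, 0 < f t x
  domain : InSpaceTimeDomain T κ f
  integrable : ∀ t : Set.Ico (0 : ℝ) T, ∀ᵐ w ∂P,
    IntegrableOn (fun s : Set.Ico (0 : ℝ) T =>
      spaceTimeGen T κ f (s : ℝ) (w s) / f (s : ℝ) (w s)) (Set.Iic t) (timeMeasure T)
  martingale : Martingale (expMart κ f) (pathFiltration T E) P

/-- `R` is a probability measure with `dR_t / dP_t = E_t^f(X)` on `ℱ_t`, for all `t < T`. -/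
def IsInducedBy [Fact (0 < T)] (P : Measure (PathSpace T E)) (κ : ℝ≥0 → Kernel E E)
    (f : ℝ → E → ℝ) (R : Measure (PathSpace T E)) : Prop :=
  IsProbabilityMeasure R ∧ ∀ t : Set.Ico (0 : ℝ) T, ∀ B : Set (PathSpace T E),
    MeasurableSet[pathFiltration T E t] B → R B = ∫⁻ w in B, ENNReal.ofReal (expMart κ f t w) ∂P

open Classical in
/-- The measure `P^f` induced by `f`, on `ℱ_T = σ(X_s : s < T)`. It is unique, since the `ℱ_t`
generate `ℱ_T`. (The value is `0` if there is no such measure.) -/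
def inducedMeasure [Fact (0 < T)] (P : Measure (PathSpace T E)) (κ : ℝ≥0 → Kernel E E)
    (f : ℝ → E → ℝ) : Measure (PathSpace T E) :=
  if H : ∃ R, IsInducedBy P κ f R then H.choose else 0

/-- `Ψ_{t,f}(X) = exp (∫_0^t (𝒜f / f)(s, X_s) ds)` for `t < T`. -/
def psi (κ : ℝ≥0 → Kernel E E) (f : ℝ → E → ℝ) (t : Set.Ico (0 : ℝ) T) (w : PathSpace T E) : ℝ :=
  Real.exp (∫ s in Set.Iic t, spaceTimeGen T κ f (s : ℝ) (w s) / f (s : ℝ) (w s) ∂timeMeasure T)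

/-- `Ψ_{T,f}(X) = exp (∫_0^T (𝒜f / f)(s, X_s) ds)`. -/
def psiT (κ : ℝ≥0 → Kernel E E) (f : ℝ → E → ℝ) (w : PathSpace T E) : ℝ :=
  Real.exp (∫ s, spaceTimeGen T κ f (s : ℝ) (w s) / f (s : ℝ) (w s) ∂timeMeasure T)

/-- The conditions (a)-(e), for the process with law `P` and transition function `κ`, the
functions `g`, `h`, and the events `A k t = A_k^t`, `t ∈ [t₀, T)`. The filter `atTop` on
`[0, T)` is the limit `t ↑ T`. -/
structure GuidingConditions [Fact (0 < T)] (P : Measure (PathSpace T E)) (κ : ℝ≥0 → Kernel E E)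
    (g h : ℝ → E → ℝ) (t₀ : Set.Ico (0 : ℝ) T)
    (A : ℕ → Set.Ico (0 : ℝ) T → Set (PathSpace T E)) : Prop where
  g_mem : MemH P κ g
  h_mem : MemH P κ h
  h_harmonic : ∀ t ∈ Set.Ico 0 T, ∀ x, spaceTimeGen T κ h t x = 0
  /-- the events are adapted -/
  events_adapted : ∀ k t, t₀ ≤ t → MeasurableSet[pathFiltration T E t] (A k t)
  /-- (a) -/
  events_mono : ∀ k t, t₀ ≤ t → A k t ⊆ A (k + 1) t
  events_anti : ∀ k s t, t₀ ≤ s → s ≤ t → A k t ⊆ A k s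
  /-- (b) -/
  g_integrable : ∀ t, t₀ ≤ t → Integrable (fun w : PathSpace T E => g t (w t)) P
  condExp_bounded : ∀ s, t₀ ≤ s → ∃ C : ℝ, ∀ t, s ≤ t →
    ∀ᵐ w ∂P, (P[fun w : PathSpace T E => g t (w t) | pathFiltration T E s]) w ≤ C
  condExp_tendsto : ∀ s : Set.Ico (0 : ℝ) T, t₀ ≤ s → ∀ x,
    Tendsto (fun t : Set.Ico (0 : ℝ) T => condExpAt κ (g t) s t x) atTop (𝓝 (h s x))
  /-- (c) -/
  fraction : ∃ l : ℕ → ℝ,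
    (∀ k, Tendsto (fun t : Set.Ico (0 : ℝ) T =>
      ∫ w in A k t, g t (w t) / h t (w t) ∂(inducedMeasure P κ h)) atTop (𝓝 (l k))) ∧
    Tendsto l atTop (𝓝 1)
  /-- (d) -/
  psi_bounded : ∀ k, ∃ C : ℝ, ∀ t, t₀ ≤ t →
    ∀ᵐ w ∂(inducedMeasure P κ g), (A k t).indicator (psi κ g t) w ≤ C
  /-- `Ψ_{T,g}(X)` is well defined -/
  psi_integrable : ∀ᵐ w ∂(inducedMeasure P κ g), Integrable (fun s : Set.Ico (0 : ℝ) T =>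
    spaceTimeGen T κ g (s : ℝ) (w s) / g (s : ℝ) (w s)) (timeMeasure T)
  /-- (e) -/
  full : inducedMeasure P κ g (⋂ t : Set.Ici t₀, ⋃ k, A k t) = 1

end Markov

/-! ### Transport along a homeomorphism -/

section Transport

variable {T : ℝ} {E F : Type*} [TopologicalSpace E] [MeasurableSpace E] [BorelSpace E]
  [TopologicalSpace F] [MeasurableSpace F] [BorelSpace F]

/-- The path `t ↦ Φ(w t)`. -/
def mapPath (Φ : E ≃ₜ F) (w : PathSpace T E) : PathSpace T F := (Φ : C(E, F)).comp w

/-- The transition function of `Y = Φ(X)`: the law of `Φ(X_t)` given `X_0 = Φ⁻¹(y)`. -/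
def mapTransition (Φ : E ≃ₜ F) (κ : ℝ≥0 → Kernel E E) (t : ℝ≥0) : Kernel F F :=
  ((κ t).comap Φ.symm Φ.symm.continuous.measurable).map Φ

/-- `(Φ_* f)(t, y) = f(t, Φ⁻¹(y))`. -/
def pushforwardFun (Φ : E ≃ₜ F) (f : ℝ → E → ℝ) : ℝ → F → ℝ := fun t y => f t (Φ.symm y)

end Transport

/-! ### Brownian motion with drift on a Riemannian manifold -/

section Riemannian

variable {d : ℕ} {M : Type*} [TopologicalSpace M] [ChartedSpace (EuclideanSpace ℝ (Fin d)) M]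
  [IsManifold (𝓡 d) ∞ M]

variable (d M) in
/-- Smooth Riemannian metrics on `M`. -/
abbrev Metric := Bundle.ContMDiffRiemannianMetric (𝓡 d) ∞ (EuclideanSpace ℝ (Fin d))
  (fun x : M => TangentSpace (𝓡 d) x)

/-- The `i`-th standard basis vector of `ℝ^d`. -/
def stdVec (i : Fin d) : EuclideanSpace ℝ (Fin d) := EuclideanSpace.single i 1

/-- The coordinate vector field `∂_i` of the chart at `x`, at the point with coordinates `y`. -/
def coordVec (x : M) (i : Fin d) (y : EuclideanSpace ℝ (Fin d)) :
    TangentSpace (𝓡 d) ((extChartAt (𝓡 d) x).symm y) :=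
  mfderiv 𝓘(ℝ, EuclideanSpace ℝ (Fin d)) (𝓡 d) (extChartAt (𝓡 d) x).symm y (stdVec i)

/-- The matrix `(g_ij)` of the metric in the chart at `x`, as a function of the coordinates. -/
def metricMatrix (G : Metric d M) (x : M) (y : EuclideanSpace ℝ (Fin d)) :
    Matrix (Fin d) (Fin d) ℝ :=
  Matrix.of fun i j => G.inner ((extChartAt (𝓡 d) x).symm y) (coordVec x i y) (coordVec x j y)

/-- The Laplace-Beltrami operator
`Δf = (det g)^{-1/2} ∑_i ∂_i ((det g)^{1/2} ∑_j g^{ij} ∂_j f)`, computed at `x` in the chart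
at `x`. -/
def laplaceBeltrami (G : Metric d M) (f : M → ℝ) (x : M) : ℝ :=
  let ρ : EuclideanSpace ℝ (Fin d) → ℝ := fun y => Real.sqrt (metricMatrix G x y).det
  let f' : EuclideanSpace ℝ (Fin d) → ℝ := f ∘ (extChartAt (𝓡 d) x).symm
  (ρ (extChartAt (𝓡 d) x x))⁻¹ * ∑ i, fderiv ℝ
    (fun y => ρ y * ∑ j, (metricMatrix G x y)⁻¹ i j * fderiv ℝ f' y (stdVec j))
    (extChartAt (𝓡 d) x x) (stdVec i)

/-- The derivative `Vf` of a function along a vector field. -/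
def vecDeriv (V : (x : M) → TangentSpace (𝓡 d) x) (f : M → ℝ) (x : M) : ℝ :=
  mfderiv (𝓡 d) 𝓘(ℝ, ℝ) f x (V x)

/-- `κ` is the transition function of Brownian motion with drift `V` on the compact Riemannian
manifold `(M, G)`, that is of the diffusion with generator `ℒφ = Vφ + ½Δφ` for `φ ∈ C²(M)`
(limit in the uniform norm). -/
structure IsBrownianWithDrift [MeasurableSpace M] (G : Metric d M)
    (V : (x : M) → TangentSpace (𝓡 d) x) (κ : ℝ≥0 → Kernel M M) : Prop where
  semigroup : IsTransitionSemigroup κ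
  generator_eq : ∀ φ : M → ℝ, ContMDiff (𝓡 d) 𝓘(ℝ, ℝ) 2 φ →
    TendstoUniformly (diffQuot κ φ) (fun x => vecDeriv V φ x + laplaceBeltrami G φ x / 2)
      (𝓝[>] (0 : ℝ≥0))

end Riemannian

end GuidedProcess

end

open GuidedProcess

/-! The induced measures are computed on each `ℱ_t`, `t < T`, where `P^g` and `P^h` have explicit
densities with respect to `P`. Since `𝒜h = 0`, the density of `P^h` is `h(t, X_t) / h(0, x₀)`, and the
one of `P^g`, multiplied by `Ψ_{t,g}`, is `g(t, X_t) / g(0, x₀)`. With `c = g(0, x₀) / h(0, x₀)` this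
gives, for `D ∈ ℱ_s` and `s ≤ t < T`,

  `c 𝔼^g(Ψ_{t,g} 1_D) = 𝔼(g(t, X_t) 1_D) / h(0, x₀) → 𝔼(h(s, X_s) 1_D) / h(0, x₀) = P^h(D)`

as `t ↑ T`, by the Markov property, (b) and dominated convergence
(`GuidingConditions.tendsto_lintegral_psi`). It remains to take the limit inside `𝔼^g`. Fatou's lemma
gives `c 𝔼^g(Ψ_{T,g} 1_D) ≤ P^h(D)`. In the other direction, (c) says that in the limit the events
`A_k^t` carry the whole mass of `c 𝔼^g(Ψ_{t,g})`, and by (d) the reverse Fatou lemma applies to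
`Ψ_{t,g} 1_{A_k^t}`; hence `1 ≤ c 𝔼^g(Ψ_{T,g})` (`GuidingConditions.one_le_lintegral_psiT`). So the
measure `c Ψ_{T,g} P^g` is a probability measure that is dominated by `P^h` on all `ℱ_s`, and the two
coincide (`GuidingConditions.inducedMeasure_eq_withDensity`). As `Ψ_{T,g} > 0`, the measures `P^g` and
`P^h` are equivalent. None of this uses more of the state space than its measurable structure.

For `Y = Φ(X)`, the map `w ↦ Φ ∘ w` is an isomorphism of the path spaces that identifies the
filtrations and intertwines all the objects in the conditions; the induced measures correspond to each
other because they are determined by their values on the `ℱ_t`. So the conditions hold for `Y`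
(`GuidingConditions.mapPath`), and the general result applies to `Y` itself.

If `∂_t g + ½Δg = 0`, then `𝒜g = Vg` because generators are limits and limits are unique, and
`Vg / g = V (log g)` by the chain rule. -/

noncomputable section

namespace GuidedProcess

/-! ### The filtration of path space and uniqueness of induced measures -/

section PathMeasurability

variable {T : ℝ} {E : Type*} [TopologicalSpace E] [MeasurableSpace E]

lemma measurable_eval_pathFiltration {s t : Set.Ico (0 : ℝ) T} (hst : s ≤ t) :
    Measurable[pathFiltration T E t] (fun w : PathSpace T E => w s) := by
  refine Measurable.of_comap_le ?_
  exact le_iSup (fun q : {q : Set.Ico (0 : ℝ) T // q ≤ t} =>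
    MeasurableSpace.comap (fun w : PathSpace T E => w q.1) inferInstance) ⟨s, hst⟩

lemma measurable_eval (s : Set.Ico (0 : ℝ) T) :
    Measurable (fun w : PathSpace T E => w s) :=
  (measurable_eval_pathFiltration le_rfl).mono ((pathFiltration T E).le s) le_rfl

lemma measurable_to_path {α : Type*} [MeasurableSpace α] {f : α → PathSpace T E}
    (hf : ∀ s, Measurable fun a => f a s) : Measurable f := by
  refine Measurable.of_le_map (iSup_le fun s => ?_)
  rw [← MeasurableSpace.comap_le_iff_le_map, MeasurableSpace.comap_comp]
  exact (hf s).comap_le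

lemma measurable_to_pathFiltration {α : Type*} {mα : MeasurableSpace α} {f : α → PathSpace T E}
    {t : Set.Ico (0 : ℝ) T} (hf : ∀ s ≤ t, Measurable fun a => f a s) :
    Measurable[mα, pathFiltration T E t] f := by
  refine Measurable.of_le_map (iSup_le fun s => ?_)
  rw [← MeasurableSpace.comap_le_iff_le_map, MeasurableSpace.comap_comp]
  exact (hf s.1 s.2).comap_le

/-- Finite measures on path space with the same mass are determined by their restrictions to
`ℱ_t` for `t` close to `T`. -/
lemma measure_eq_of_forall_pathFiltration {μ ν : Measure (PathSpace T E)} [IsFiniteMeasure μ]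
    (huniv : μ univ = ν univ) (t₀ : Set.Ico (0 : ℝ) T)
    (h : ∀ t, t₀ ≤ t → ∀ B, MeasurableSet[pathFiltration T E t] B → μ B = ν B) : μ = ν := by
  refine ext_of_generate_finite
    (⋃ t : Set.Ico (0 : ℝ) T, {B | MeasurableSet[pathFiltration T E t] B}) ?_ ?_ ?_ huniv
  · refine Eq.trans ?_ (MeasurableSpace.generateFrom_iUnion_measurableSet _).symm
    refine le_antisymm (iSup_le fun s => le_iSup_of_le s ?_)
      (iSup_le fun t => (pathFiltration T E).le t)
    exact (measurable_eval_pathFiltration le_rfl).comap_le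
  · exact isPiSystem_iUnion_of_monotone _ (fun t => @MeasurableSpace.isPiSystem_measurableSet _
      (pathFiltration T E t)) fun s t hst B hB => (pathFiltration T E).mono hst B hB
  · intro B hB
    obtain ⟨t, ht⟩ := mem_iUnion.1 hB
    exact h (max t t₀) (le_max_right _ _) B ((pathFiltration T E).mono (le_max_left _ _) B ht)

variable [Fact (0 < T)] {P : Measure (PathSpace T E)} {κ : ℝ≥0 → Kernel E E} {f : ℝ → E → ℝ}

lemma inducedMeasure_eq {R : Measure (PathSpace T E)} (hR : IsInducedBy P κ f R) :
    inducedMeasure P κ f = R := by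
  have H : ∃ R, IsInducedBy P κ f R := ⟨R, hR⟩
  rw [inducedMeasure, dif_pos H]
  have h1 := H.choose_spec
  have := h1.1
  have := hR.1
  refine measure_eq_of_forall_pathFiltration (by simp) (startTime T) fun t _ B hB => ?_
  rw [h1.2 t B hB, hR.2 t B hB]

lemma isInducedBy_inducedMeasure (h : inducedMeasure P κ f ≠ 0) :
    IsInducedBy P κ f (inducedMeasure P κ f) := by
  by_cases H : ∃ R, IsInducedBy P κ f R
  · rw [inducedMeasure, dif_pos H]
    exact H.choose_spec
  · rw [inducedMeasure, dif_neg H] at h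
    exact absurd rfl h

end PathMeasurability

/-! ### Transport along a homeomorphism -/

section TransportLemmas

/-- Conditional expectations are natural under isomorphisms of measurable spaces that identify the
conditioning σ-algebras. -/
lemma condExp_map_equiv {Ω Ω' : Type*} {m mΩ : MeasurableSpace Ω}
    {m' mΩ' : MeasurableSpace Ω'} (e : Ω ≃ᵐ Ω') (hm : m ≤ mΩ) (hm' : m' ≤ mΩ')
    (he : Measurable[m, m'] e) (he' : Measurable[m', m] e.symm)
    (μ : Measure Ω) [IsFiniteMeasure μ] (f : Ω' → ℝ) :
    (fun x => ((μ.map e)[f | m']) (e x)) =ᵐ[μ] μ[fun x => f (e x) | m] := by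
  by_cases hf : Integrable f (μ.map e)
  · have hfe : Integrable (fun x => f (e x)) μ := e.measurableEmbedding.integrable_map_iff.1 hf
    refine ae_eq_condExp_of_forall_setIntegral_eq hm hfe (fun s _ _ => ?_) (fun s hs _ => ?_) ?_
    · exact (e.measurableEmbedding.integrable_map_iff.1 integrable_condExp).integrableOn
    · have hs' : MeasurableSet[m'] (e.symm ⁻¹' s) := he' hs
      have hpre : e ⁻¹' (e.symm ⁻¹' s) = s := by ext; simp
      have := setIntegral_condExp hm' hf hs'
      rwa [e.measurableEmbedding.setIntegral_map, e.measurableEmbedding.setIntegral_map, hpre]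
        at this
    · exact (stronglyMeasurable_condExp.comp_measurable he).aestronglyMeasurable
  · have hfe : ¬ Integrable (fun x => f (e x)) μ := fun h =>
      hf (e.measurableEmbedding.integrable_map_iff.2 h)
    rw [condExp_of_not_integrable hf, condExp_of_not_integrable hfe]
    rfl

variable {T : ℝ} {E F : Type*} [TopologicalSpace E] [TopologicalSpace F] (φ : E ≃ₜ F)

@[simp] lemma mapPath_apply (w : PathSpace T E) (t : Set.Ico (0 : ℝ) T) :
    mapPath φ w t = φ (w t) := rfl

@[simp] lemma mapPath_symm_mapPath (w : PathSpace T E) : mapPath φ.symm (mapPath φ w) = w := by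
  ext t; simp

@[simp] lemma mapPath_mapPath_symm (w : PathSpace T F) : mapPath φ (mapPath φ.symm w) = w := by
  ext t; simp

variable [MeasurableSpace E] [BorelSpace E] [MeasurableSpace F] [BorelSpace F]

lemma measurable_mapPath_pathFiltration (t : Set.Ico (0 : ℝ) T) :
    Measurable[pathFiltration T E t, pathFiltration T F t] (mapPath (T := T) φ) :=
  measurable_to_pathFiltration fun _ hs =>
    φ.continuous.measurable.comp (measurable_eval_pathFiltration hs)

lemma measurable_mapPath : Measurable (mapPath (T := T) φ) :=
  measurable_to_path fun s => φ.continuous.measurable.comp (measurable_eval s)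

variable (T) in
/-- The isomorphism `w ↦ Φ ∘ w` between the path spaces of homeomorphic state spaces. -/
def mapPathEquiv : PathSpace T E ≃ᵐ PathSpace T F where
  toFun := mapPath φ
  invFun := mapPath φ.symm
  left_inv := mapPath_symm_mapPath φ
  right_inv := mapPath_mapPath_symm φ
  measurable_toFun := measurable_mapPath φ
  measurable_invFun := measurable_mapPath φ.symm

lemma measurableEmbedding_mapPath : MeasurableEmbedding (mapPath (T := T) φ) :=
  (mapPathEquiv T φ).measurableEmbedding

lemma condExp_mapPath (P : Measure (PathSpace T E)) [IsFiniteMeasure P] (s : Set.Ico (0 : ℝ) T)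
    (f : PathSpace T F → ℝ) :
    (fun w => ((P.map (mapPath φ))[f | pathFiltration T F s]) (mapPath φ w))
      =ᵐ[P] P[fun w => f (mapPath φ w) | pathFiltration T E s] :=
  condExp_map_equiv (mapPathEquiv T φ) ((pathFiltration T E).le s) ((pathFiltration T F).le s)
    (measurable_mapPath_pathFiltration φ s) (measurable_mapPath_pathFiltration φ.symm s) P f

variable (κ : ℝ≥0 → Kernel E E)

lemma mapTransition_apply (t : ℝ≥0) (y : F) :
    mapTransition φ κ t y = (κ t (φ.symm y)).map φ := by
  rw [mapTransition, Kernel.map_apply _ φ.continuous.measurable, Kernel.comap_apply]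

lemma integral_mapTransition (t : ℝ≥0) (y : F) (f : F → ℝ) :
    ∫ z, f z ∂(mapTransition φ κ t y) = ∫ x, f (φ x) ∂(κ t (φ.symm y)) := by
  rw [mapTransition_apply, φ.measurableEmbedding.integral_map]

lemma condExpAt_mapTransition (f : F → ℝ) (s t : ℝ) (y : F) :
    condExpAt (mapTransition φ κ) f s t y = condExpAt κ (fun x => f (φ x)) s t (φ.symm y) :=
  integral_mapTransition ..

lemma diffQuot_mapTransition (f : E → ℝ) (t : ℝ≥0) (y : F) :
    diffQuot (mapTransition φ κ) (fun y => f (φ.symm y)) t y = diffQuot κ f t (φ.symm y) := by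
  simp [diffQuot, integral_mapTransition]

lemma generator_mapTransition (f : E → ℝ) (y : F) :
    generator (mapTransition φ κ) (fun y => f (φ.symm y)) y = generator κ f (φ.symm y) := by
  simp only [generator, diffQuot_mapTransition]

lemma InGeneratorDomain.mapTransition {κ : ℝ≥0 → Kernel E E} {f : E → ℝ}
    (h : InGeneratorDomain κ f) :
    InGeneratorDomain (mapTransition φ κ) (fun y => f (φ.symm y)) := by
  intro y
  obtain ⟨h1, l, hl⟩ := h (φ.symm y)
  refine ⟨?_, l, by simpa only [diffQuot_mapTransition] using hl⟩
  filter_upwards [h1] with t ht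
  rw [mapTransition_apply, φ.measurableEmbedding.integrable_map_iff]
  simpa [Function.comp_def] using ht

lemma spaceTimeGen_mapTransition (f : ℝ → E → ℝ) (t : ℝ) (y : F) :
    spaceTimeGen T (mapTransition φ κ) (pushforwardFun φ f) t y
      = spaceTimeGen T κ f t (φ.symm y) := by
  exact congrArg _ (generator_mapTransition φ κ (f t) y)

lemma psi_mapPath (f : ℝ → E → ℝ) (t : Set.Ico (0 : ℝ) T) (w : PathSpace T E) :
    psi (mapTransition φ κ) (pushforwardFun φ f) t (mapPath φ w) = psi κ f t w := by
  simp [psi, spaceTimeGen_mapTransition, pushforwardFun]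

lemma expMart_mapPath [Fact (0 < T)] (f : ℝ → E → ℝ) (t : Set.Ico (0 : ℝ) T) (w : PathSpace T E) :
    expMart (mapTransition φ κ) (pushforwardFun φ f) t (mapPath φ w) = expMart κ f t w := by
  simp [expMart, spaceTimeGen_mapTransition, pushforwardFun]

variable {κ}

lemma IsTransitionSemigroup.mapTransition (h : IsTransitionSemigroup κ) :
    IsTransitionSemigroup (mapTransition φ κ) where
  isMarkov t := by
    have := h.isMarkov t
    unfold GuidedProcess.mapTransition
    exact Kernel.IsMarkovKernel.map _ φ.continuous.measurable
  zero := by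
    ext y : 1
    rw [mapTransition_apply, h.zero, Kernel.id_apply, Kernel.id_apply,
      Measure.map_dirac' φ.continuous.measurable, φ.apply_symm_apply]
  chapman_kolmogorov s t := by
    ext y B hB
    rw [mapTransition_apply, h.chapman_kolmogorov, Kernel.comp_apply' _ _ _ hB,
      mapTransition_apply, φ.measurableEmbedding.map_apply, φ.measurableEmbedding.lintegral_map,
      Kernel.comp_apply' _ _ _ (φ.continuous.measurable hB)]
    simp [mapTransition_apply, φ.measurableEmbedding.map_apply]

variable [Fact (0 < T)] {P : Measure (PathSpace T E)} {f : ℝ → E → ℝ}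

lemma IsMarkovLaw.mapPath {x₀ : E} (h : IsMarkovLaw P κ x₀) :
    IsMarkovLaw (P.map (mapPath φ)) (mapTransition φ κ) (φ x₀) where
  isProbability := by
    have := h.isProbability
    exact Measure.isProbabilityMeasure_map (measurable_mapPath φ).aemeasurable
  start := by
    rw [(measurableEmbedding_mapPath φ).ae_map_iff]
    filter_upwards [h.start] with w hw
    simp [hw]
  markov s t hst B hB := by
    have := h.isProbability
    rw [EventuallyEq, (measurableEmbedding_mapPath φ).ae_map_iff]
    filter_upwards [condExp_mapPath φ P s fun w => B.indicator (fun _ => (1 : ℝ)) (w t),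
      h.markov s t hst (φ ⁻¹' B) (φ.continuous.measurable hB)] with w h1 h2
    rw [h1, condExpAt_mapTransition, mapPath_apply, φ.symm_apply_apply]
    exact h2

lemma MemH.mapPath [IsFiniteMeasure P] (h : MemH P κ f) :
    MemH (P.map (mapPath φ)) (mapTransition φ κ) (pushforwardFun φ f) where
  measurable := by
    have : Measurable fun p : Set.Ico (0 : ℝ) T × F => (p.1, φ.symm p.2) :=
      measurable_fst.prodMk (φ.symm.continuous.measurable.comp measurable_snd)
    exact h.measurable.comp this
  pos t ht y := h.pos t ht _
  domain t ht := ⟨(h.domain t ht).1.mapTransition φ, fun y => (h.domain t ht).2 _⟩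
  integrable t := by
    rw [(measurableEmbedding_mapPath φ).ae_map_iff]
    simpa [spaceTimeGen_mapTransition, pushforwardFun] using h.integrable t
  martingale := by
    constructor
    · intro t
      have := (h.martingale.1 t).comp_measurable (measurable_mapPath_pathFiltration φ.symm t)
      convert! this using 1
      ext w
      rw [Function.comp_apply, ← expMart_mapPath φ, mapPath_mapPath_symm]
    · intro s t hst
      rw [EventuallyEq, (measurableEmbedding_mapPath φ).ae_map_iff]
      filter_upwards [condExp_mapPath φ P s
        (expMart (GuidedProcess.mapTransition φ κ) (pushforwardFun φ f) t),
        h.martingale.2 s t hst] with w h1 h2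
      simp only [expMart_mapPath] at h1 ⊢
      rw [h1, h2]

lemma IsInducedBy.mapPath {R : Measure (PathSpace T E)} (h : IsInducedBy P κ f R) :
    IsInducedBy (P.map (mapPath φ)) (mapTransition φ κ) (pushforwardFun φ f)
      (R.map (mapPath φ)) := by
  have := h.1
  refine ⟨Measure.isProbabilityMeasure_map (measurable_mapPath φ).aemeasurable, fun t B hB => ?_⟩
  rw [(measurableEmbedding_mapPath φ).map_apply, (measurableEmbedding_mapPath φ).restrict_map,
    (measurableEmbedding_mapPath φ).lintegral_map,
    h.2 t _ (measurable_mapPath_pathFiltration φ t hB)]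
  simp only [expMart_mapPath]

end TransportLemmas

/-! ### Densities of the induced measures on `ℱ_t` -/

section Density

variable {T : ℝ} {E : Type*} [TopologicalSpace E] [MeasurableSpace E]
  {κ : ℝ≥0 → Kernel E E} {f : ℝ → E → ℝ}

lemma psi_of_harmonic (hf : ∀ t ∈ Set.Ico 0 T, ∀ x, spaceTimeGen T κ f t x = 0)
    (t : Set.Ico (0 : ℝ) T) (w : PathSpace T E) : psi κ f t w = 1 := by
  have : ∀ s : Set.Ico (0 : ℝ) T, spaceTimeGen T κ f s (w s) = 0 := fun s => hf s s.2 _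
  simp [psi, this]

variable [Fact (0 < T)] {P ν : Measure (PathSpace T E)} {x₀ : E}

lemma MemH.measurable_slice (hf : MemH P κ f) (t : Set.Ico (0 : ℝ) T) : Measurable (f t) :=
  hf.measurable.comp (measurable_const.prodMk measurable_id)

lemma MemH.measurable_eval (hf : MemH P κ f) {s t : Set.Ico (0 : ℝ) T} (hst : s ≤ t) :
    Measurable[pathFiltration T E t] (fun w : PathSpace T E => f s (w s)) :=
  (hf.measurable_slice s).comp (measurable_eval_pathFiltration hst)

lemma psi_mul_expMart (t : Set.Ico (0 : ℝ) T) (w : PathSpace T E) :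
    psi κ f t w * expMart κ f t w = f t (w t) / f 0 (w (startTime T)) := by
  rw [psi, expMart, Real.exp_neg]
  field_simp

/-- Adaptedness of `Ψ_{t,f}` follows from that of the martingale `E^f`, which spares any joint
measurability of `(s, w) ↦ (𝒜f / f)(s, w s)`. -/
lemma MemH.measurable_psi (hf : MemH P κ f) (t : Set.Ico (0 : ℝ) T) :
    Measurable[pathFiltration T E t] (psi (T := T) κ f t) := by
  have h0 : Measurable[pathFiltration T E t] (fun w : PathSpace T E => f 0 (w (startTime T))) :=
    hf.measurable_eval (s := startTime T) t.2.1
  have h : psi (T := T) κ f t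
      = fun w => f t (w t) / f 0 (w (startTime T)) / expMart κ f t w := by
    ext w
    have h1 : 0 < f t (w t) / f 0 (w (startTime T)) :=
      div_pos (hf.pos _ t.2 _) (hf.pos 0 (startTime T).2 _)
    have h2 : expMart κ f t w ≠ 0 := (mul_pos h1 (Real.exp_pos _)).ne'
    rw [eq_div_iff h2, psi_mul_expMart]
  rw [h]
  exact ((hf.measurable_eval le_rfl).div h0).div (hf.martingale.1 t).measurable

lemma IsInducedBy.lintegral_eq (hf : MemH P κ f) (hR : IsInducedBy P κ f ν)
    {t : Set.Ico (0 : ℝ) T} {F : PathSpace T E → ℝ≥0∞} (hF : Measurable[pathFiltration T E t] F) :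
    ∫⁻ w, F w ∂ν = ∫⁻ w, ENNReal.ofReal (expMart κ f t w) * F w ∂P := by
  have hle := (pathFiltration T E).le t
  have hm : Measurable (fun w => ENNReal.ofReal (expMart κ f t w)) :=
    ((hf.martingale.1 t).measurable.ennreal_ofReal).mono hle le_rfl
  have hEq : ν.trim hle = (P.withDensity fun w => ENNReal.ofReal (expMart κ f t w)).trim hle := by
    refine @Measure.ext _ (pathFiltration T E t) _ _ fun B hB => ?_
    rw [trim_measurableSet_eq hle hB, trim_measurableSet_eq hle hB, hR.2 t B hB,
      withDensity_apply _ (hle B hB)]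
  rw [← lintegral_trim hle hF, hEq, lintegral_trim hle hF,
    lintegral_withDensity_eq_lintegral_mul _ hm (hF.mono hle le_rfl)]
  rfl

/-- Multiplying by `Ψ_{t,f}` removes the exponential factor of `dP^f/dP`:
`f(0, x₀) 𝔼^f(F Ψ_{t,f}) = 𝔼(F f(t, X_t))` for `F ≥ 0` measurable for `ℱ_t`. -/
lemma IsInducedBy.lintegral_mul_psi (hP : IsMarkovLaw P κ x₀) (hf : MemH P κ f)
    (hR : IsInducedBy P κ f ν) {t : Set.Ico (0 : ℝ) T} {F : PathSpace T E → ℝ≥0∞}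
    (hF : Measurable[pathFiltration T E t] F) :
    ENNReal.ofReal (f 0 x₀) * ∫⁻ w, F w * ENNReal.ofReal (psi κ f t w) ∂ν
      = ∫⁻ w, F w * ENNReal.ofReal (f t (w t)) ∂P := by
  rw [hR.lintegral_eq hf (F := fun w => F w * ENNReal.ofReal (psi κ f t w))
      (hF.mul (hf.measurable_psi t).ennreal_ofReal),
    ← lintegral_const_mul' _ _ ENNReal.ofReal_ne_top]
  refine lintegral_congr_ae ?_
  filter_upwards [hP.start] with w hw
  have h0 : 0 < f 0 x₀ := hf.pos 0 (startTime T).2 _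
  have h1 : f t (w t) = f 0 x₀ * (psi κ f t w * expMart κ f t w) := by
    rw [psi_mul_expMart, hw]
    field_simp
  rw [h1, ENNReal.ofReal_mul h0.le,
    ENNReal.ofReal_mul (show 0 ≤ psi κ f t w from (Real.exp_pos _).le)]
  ring

lemma lintegral_indicator_one_mul {α : Type*} {_ : MeasurableSpace α} (μ : Measure α) {D : Set α}
    (hD : MeasurableSet D) (F : α → ℝ≥0∞) :
    ∫⁻ a, D.indicator (fun _ => 1) a * F a ∂μ = ∫⁻ a in D, F a ∂μ := by
  rw [← lintegral_indicator hD]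
  refine lintegral_congr fun a => ?_
  by_cases ha : a ∈ D <;> simp [ha]

lemma IsInducedBy.setLIntegral_psi (hP : IsMarkovLaw P κ x₀) (hf : MemH P κ f)
    (hR : IsInducedBy P κ f ν) {t : Set.Ico (0 : ℝ) T} {D : Set (PathSpace T E)}
    (hD : MeasurableSet[pathFiltration T E t] D) :
    ENNReal.ofReal (f 0 x₀) * ∫⁻ w in D, ENNReal.ofReal (psi κ f t w) ∂ν
      = ∫⁻ w in D, ENNReal.ofReal (f t (w t)) ∂P := by
  have hD' := (pathFiltration T E).le t D hD
  have := hR.lintegral_mul_psi hP hf ((measurable_const (a := (1 : ℝ≥0∞))).indicator hD)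
  rwa [lintegral_indicator_one_mul _ hD', lintegral_indicator_one_mul _ hD'] at this

lemma IsInducedBy.lintegral_of_harmonic (hP : IsMarkovLaw P κ x₀) (hf : MemH P κ f)
    (hR : IsInducedBy P κ f ν) (hharm : ∀ t ∈ Set.Ico 0 T, ∀ x, spaceTimeGen T κ f t x = 0)
    {t : Set.Ico (0 : ℝ) T} {F : PathSpace T E → ℝ≥0∞} (hF : Measurable[pathFiltration T E t] F) :
    ENNReal.ofReal (f 0 x₀) * ∫⁻ w, F w ∂ν = ∫⁻ w, F w * ENNReal.ofReal (f t (w t)) ∂P := by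
  rw [← hR.lintegral_mul_psi hP hf hF]
  simp [psi_of_harmonic hharm]

end Density

/-! ### The Markov property for unbounded functions -/

section MarkovProperty

variable {T : ℝ} {E : Type*} [TopologicalSpace E] [MeasurableSpace E] [Fact (0 < T)]
  {P : Measure (PathSpace T E)} {κ : ℝ≥0 → Kernel E E} {x₀ : E}

/-- The Markov property as an identity of measures: on an event `D ∈ ℱ_s`, the law of `X_t` is
obtained from that of `X_s` by running the kernel for the time `t - s`. -/
lemma IsMarkovLaw.map_restrict (hκ : IsTransitionSemigroup κ) (hP : IsMarkovLaw P κ x₀)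
    {s t : Set.Ico (0 : ℝ) T} (hst : s ≤ t) {D : Set (PathSpace T E)}
    (hD : MeasurableSet[pathFiltration T E s] D) :
    (P.restrict D).map (fun w => w t)
      = ((P.restrict D).map fun w => w s).bind (κ ((t : ℝ) - s).toNNReal) := by
  have := hP.isProbability
  have := hκ.isMarkov
  have hle := (pathFiltration T E).le s
  ext B hB
  have hBt : MeasurableSet ((fun w : PathSpace T E => w t) ⁻¹' B) := measurable_eval t hB
  rw [Measure.bind_apply hB (Kernel.aemeasurable _),
    lintegral_map (Kernel.measurable_coe _ hB) (measurable_eval s), Measure.map_apply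
    (measurable_eval t) hB]
  have hind : (fun w : PathSpace T E => B.indicator (fun _ => (1 : ℝ)) (w t))
      = ((fun w : PathSpace T E => w t) ⁻¹' B).indicator fun _ => 1 := rfl
  have hint : Integrable (fun w : PathSpace T E => B.indicator (fun _ => (1 : ℝ)) (w t)) P := by
    rw [hind]
    exact (integrable_const _).indicator hBt
  have hcond : ∀ w : PathSpace T E, condExpAt κ (B.indicator fun _ => (1 : ℝ)) s t (w s)
      = (κ ((t : ℝ) - s).toNNReal (w s)).real B := fun w => by
    rw [condExpAt, integral_indicator_const _ hB, smul_eq_mul, mul_one]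
  have hae : (fun w => (κ ((t : ℝ) - s).toNNReal (w s)).real B) =ᵐ[P]
      P[fun w => B.indicator (fun _ => (1 : ℝ)) (w t) | pathFiltration T E s] := by
    filter_upwards [hP.markov s t hst B hB] with w hw
    rw [hw, hcond]
  have key := setIntegral_condExp hle hint hD
  rw [← setIntegral_congr_ae (hle D hD) (hae.mono fun w hw _ => hw), hind,
    integral_indicator_const _ hBt, smul_eq_mul, mul_one] at key
  have hint2 : Integrable (fun w => (κ ((t : ℝ) - s).toNNReal (w s)).real B) (P.restrict D) :=
    ((integrable_congr hae).2 integrable_condExp).restrict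
  have h2 := ofReal_integral_eq_lintegral_ofReal hint2 (ae_of_all _ fun _ => measureReal_nonneg)
  rw [key] at h2
  simpa using h2

/-- `𝔼(φ(X_t) ∣ ℱ_s) = 𝔼(φ(X_t) ∣ X_s = ·)` evaluated at `X_s`, for all integrable `φ(X_t)`. -/
lemma IsMarkovLaw.condExp_eq (hκ : IsTransitionSemigroup κ) (hP : IsMarkovLaw P κ x₀)
    {s t : Set.Ico (0 : ℝ) T} (hst : s ≤ t) {φ : E → ℝ} (hφ : Measurable φ)
    (hint : Integrable (fun w : PathSpace T E => φ (w t)) P) :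
    (fun w => condExpAt κ φ s t (w s)) =ᵐ[P]
      P[fun w : PathSpace T E => φ (w t) | pathFiltration T E s] := by
  have := hP.isProbability
  have := hκ.isMarkov
  have hle := (pathFiltration T E).le s
  have hmeas : StronglyMeasurable (condExpAt κ φ (s : ℝ) t) :=
    hφ.stronglyMeasurable.integral_kernel
  have key : ∀ D, MeasurableSet[pathFiltration T E s] D →
      IntegrableOn (fun w : PathSpace T E => condExpAt κ φ s t (w s)) D P ∧
      ∫ w in D, condExpAt κ φ s t (w s) ∂P = ∫ w in D, φ (w t) ∂P := by
    intro D hD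
    have h1 : Integrable φ ((P.restrict D).map fun w => w t) :=
      (integrable_map_measure hφ.aestronglyMeasurable (measurable_eval t).aemeasurable).2
        hint.restrict
    rw [hP.map_restrict hκ hst hD, Measure.comp_eq_comp_const_apply] at h1
    have h2 := h1.integral_comp
    have h3 := Kernel.integral_comp h1
    rw [Kernel.const_apply] at h2 h3
    rw [← Measure.comp_eq_comp_const_apply, ← hP.map_restrict hκ hst hD,
      integral_map (measurable_eval t).aemeasurable hφ.aestronglyMeasurable,
      integral_map (measurable_eval s).aemeasurable
        (show AEStronglyMeasurable (fun x => ∫ y, φ y ∂(κ ((t : ℝ) - s).toNNReal x)) _ from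
          hmeas.aestronglyMeasurable)] at h3
    exact ⟨(integrable_map_measure hmeas.aestronglyMeasurable
      (measurable_eval s).aemeasurable).1 h2, h3.symm⟩
  exact ae_eq_condExp_of_forall_setIntegral_eq hle hint (fun D hD _ => (key D hD).1)
    (fun D hD _ => (key D hD).2)
    (hmeas.comp_measurable (measurable_eval_pathFiltration le_rfl)).aestronglyMeasurable

end MarkovProperty

/-! ### The likelihood ratio of the induced measures -/

section Likelihood

variable {T : ℝ}

/-- A sequence of times in `[s, T)` that tends to `T`. -/
lemma exists_seq_tendsto_end (s : Set.Ico (0 : ℝ) T) :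
    ∃ u : ℕ → Set.Ico (0 : ℝ) T, (∀ n, s ≤ u n) ∧ Tendsto u atTop atTop := by
  have hs := s.2.2
  have hpos : ∀ n : ℕ, (0 : ℝ) < (T - s) / (n + 1) := fun n => by
    have : (0 : ℝ) < T - s := by linarith
    positivity
  have hle : ∀ n : ℕ, (s : ℝ) ≤ T - (T - s) / (n + 1) := fun n => by
    have : (T - s) / ((n : ℝ) + 1) ≤ T - s :=
      div_le_self (by linarith) (by linarith [n.cast_nonneg (α := ℝ)])
    linarith
  refine ⟨fun n => ⟨T - (T - s) / (n + 1), s.2.1.trans (hle n), by linarith [hpos n]⟩, hle, ?_⟩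
  refine tendsto_atTop.2 fun b => ?_
  have hlim : Tendsto (fun n : ℕ => T - (T - s) / ((n : ℝ) + 1)) atTop (𝓝 (T - 0)) :=
    by
    refine tendsto_const_nhds.sub ?_
    simpa [Function.comp_def] using (tendsto_const_div_atTop_nhds_zero_nat (T - (s : ℝ))).comp
      (tendsto_add_atTop_nat 1)
  rw [sub_zero] at hlim
  filter_upwards [hlim.eventually (eventually_ge_nhds b.2.2)] with n hn
  exact hn

variable {E : Type*} [TopologicalSpace E] [MeasurableSpace E]
  {P : Measure (PathSpace T E)} {κ : ℝ≥0 → Kernel E E} {x₀ : E} {g h : ℝ → E → ℝ}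
  {t₀ : Set.Ico (0 : ℝ) T} {A : ℕ → Set.Ico (0 : ℝ) T → Set (PathSpace T E)}

lemma tendsto_psi {f : ℝ → E → ℝ} {w : PathSpace T E}
    (hw : Integrable (fun s : Set.Ico (0 : ℝ) T =>
      spaceTimeGen T κ f (s : ℝ) (w s) / f (s : ℝ) (w s)) (timeMeasure T))
    {u : ℕ → Set.Ico (0 : ℝ) T} (hu : Tendsto u atTop atTop) :
    Tendsto (fun n => psi κ f (u n) w) atTop (𝓝 (psiT κ f w)) := by
  refine (Real.continuous_exp.tendsto _).comp ?_
  simp_rw [← integral_indicator measurableSet_Iic]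
  refine tendsto_integral_of_dominated_convergence _
    (fun n => hw.aestronglyMeasurable.indicator measurableSet_Iic) hw.norm
    (fun n => ae_of_all _ fun s => norm_indicator_le_norm_self _ _) (ae_of_all _ fun s => ?_)
  refine tendsto_const_nhds.congr' ?_
  filter_upwards [hu.eventually_ge_atTop s] with n hn
  rw [indicator_of_mem (show s ∈ Iic (u n) from hn)]

variable [Fact (0 < T)]

lemma GuidingConditions.isInducedBy_g (hX : GuidingConditions P κ g h t₀ A) :
    IsInducedBy P κ g (inducedMeasure P κ g) := by
  refine isInducedBy_inducedMeasure fun h0 => ?_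
  have := hX.full
  simp [h0] at this

lemma GuidingConditions.isInducedBy_h (hX : GuidingConditions P κ g h t₀ A) :
    IsInducedBy P κ h (inducedMeasure P κ h) := by
  refine isInducedBy_inducedMeasure fun h0 => ?_
  obtain ⟨l, hl, hl1⟩ := hX.fraction
  have : Nonempty (Set.Ico (0 : ℝ) T) := ⟨t₀⟩
  have hl0 : ∀ k, l k = 0 := fun k => by
    have := hl k
    simp only [h0, Measure.restrict_zero, integral_zero_measure] at this
    exact tendsto_nhds_unique this tendsto_const_nhds
  simp [funext hl0] at hl1

/-- `𝔼^g(Ψ_{t,g} 1_D)` converges to a multiple of `P^h(D)` for events `D ∈ ℱ_s`, by the Markov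
property and dominated convergence. -/
lemma GuidingConditions.tendsto_lintegral_psi (hκ : IsTransitionSemigroup κ)
    (hP : IsMarkovLaw P κ x₀) (hX : GuidingConditions P κ g h t₀ A)
    {s : Set.Ico (0 : ℝ) T} (hs : t₀ ≤ s) {D : Set (PathSpace T E)}
    (hD : MeasurableSet[pathFiltration T E s] D) {u : ℕ → Set.Ico (0 : ℝ) T}
    (hu : Tendsto u atTop atTop) (hsu : ∀ n, s ≤ u n) :
    Tendsto (fun n => ENNReal.ofReal (g 0 x₀ / h 0 x₀) *
        ∫⁻ w in D, ENNReal.ofReal (psi κ g (u n) w) ∂(inducedMeasure P κ g))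
      atTop (𝓝 (inducedMeasure P κ h D)) := by
  have := hP.isProbability
  have := hκ.isMarkov
  have hle := fun t => (pathFiltration T E).le t
  have hg0 : 0 < g 0 x₀ := hX.g_mem.pos 0 (startTime T).2 _
  have hh0 : 0 < h 0 x₀ := hX.h_mem.pos 0 (startTime T).2 _
  -- the quantities in the limit, as integrals with respect to `P`
  have hG : ∀ n, ENNReal.ofReal (g 0 x₀) *
      ∫⁻ w in D, ENNReal.ofReal (psi κ g (u n) w) ∂(inducedMeasure P κ g)
      = ENNReal.ofReal (∫ w in D, condExpAt κ (g (u n)) s (u n) (w s) ∂P) := by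
    intro n
    have hDn := (pathFiltration T E).mono (hsu n) D hD
    have hint := hX.g_integrable (u n) (hs.trans (hsu n))
    rw [hX.isInducedBy_g.setLIntegral_psi hP hX.g_mem hDn, ← ofReal_integral_eq_lintegral_ofReal hint.restrict
      (ae_of_all _ fun w => (hX.g_mem.pos _ (u n).2 _).le), ← setIntegral_condExp (hle s) hint hD]
    refine congrArg _ (setIntegral_congr_ae (hle s D hD) ?_)
    filter_upwards [hP.condExp_eq hκ (hsu n) (hX.g_mem.measurable_slice _) hint] with w hw _
    exact hw.symm
  have hH : ENNReal.ofReal (h 0 x₀) * inducedMeasure P κ h D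
      = ENNReal.ofReal (∫ w in D, h s (w s) ∂P) := by
    have h1 := hX.isInducedBy_h.setLIntegral_psi hP hX.h_mem hD
    simp only [psi_of_harmonic hX.h_harmonic, ENNReal.ofReal_one, setLIntegral_one] at h1
    have := hX.isInducedBy_h.1
    rw [h1, ← ofReal_integral_eq_lintegral_ofReal _
      (ae_of_all _ fun w => (hX.h_mem.pos _ s.2 _).le)]
    refine ⟨((hX.h_mem.measurable_eval le_rfl).mono (hle s) le_rfl).aestronglyMeasurable, ?_⟩
    rw [hasFiniteIntegral_iff_ofReal (ae_of_all _ fun w => (hX.h_mem.pos _ s.2 _).le), ← h1]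
    exact ENNReal.mul_lt_top ENNReal.ofReal_lt_top (measure_lt_top _ _)
  have hlim : Tendsto (fun n => ∫ w in D, condExpAt κ (g (u n)) s (u n) (w s) ∂P) atTop
      (𝓝 (∫ w in D, h s (w s) ∂P)) := by
    obtain ⟨C, hC⟩ := hX.condExp_bounded s hs
    refine tendsto_integral_of_dominated_convergence (fun _ => C) (fun n => ?_)
      (integrable_const _) (fun n => ?_) (ae_of_all _ fun w => (hX.condExp_tendsto s hs _).comp hu)
    · exact ((hX.g_mem.measurable_slice (u n)).stronglyMeasurable.integral_kernel.comp_measurable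
        (measurable_eval s)).aestronglyMeasurable
    · refine ae_restrict_of_ae ?_
      filter_upwards [hC (u n) (hsu n), hP.condExp_eq hκ (hsu n) (hX.g_mem.measurable_slice _)
        (hX.g_integrable (u n) (hs.trans (hsu n)))] with w h1 h2
      rw [condExpAt, Real.norm_of_nonneg (integral_nonneg fun y => (hX.g_mem.pos _ (u n).2 _).le)]
      exact h2.trans_le h1
  have hh0' : ENNReal.ofReal (h 0 x₀) ≠ 0 := by simpa using hh0
  have h3 := ENNReal.Tendsto.const_mul (a := (ENNReal.ofReal (h 0 x₀))⁻¹)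
    ((ENNReal.continuous_ofReal.tendsto _).comp hlim) (Or.inr (ENNReal.inv_ne_top.2 hh0'))
  rw [← hH, ← mul_assoc, ENNReal.inv_mul_cancel hh0' ENNReal.ofReal_ne_top, one_mul] at h3
  refine h3.congr fun n => ?_
  rw [Function.comp_apply, ← hG n, ← mul_assoc, ENNReal.ofReal_div_of_pos hh0, div_eq_mul_inv,
    mul_comm (ENNReal.ofReal (h 0 x₀))⁻¹]

lemma GuidingConditions.aemeasurable_psiT (hX : GuidingConditions P κ g h t₀ A) :
    AEMeasurable (psiT κ g) (inducedMeasure P κ g) := by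
  obtain ⟨u, -, hu⟩ := exists_seq_tendsto_end t₀
  refine aemeasurable_of_tendsto_metrizable_ae atTop (fun n => ((hX.g_mem.measurable_psi (u n)).mono
    ((pathFiltration T E).le _) le_rfl).aemeasurable) ?_
  filter_upwards [hX.psi_integrable] with w hw using tendsto_psi hw hu

/-- No mass of `𝔼^g(Ψ_{t,g})` is lost as `t ↑ T`. On the events `A_k^t` the variables `Ψ_{t,g}` are
bounded by (d), so that the reverse Fatou lemma applies; by (c) these events carry the whole mass in
the limit `k → ∞`. -/
lemma GuidingConditions.one_le_lintegral_psiT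
    (hP : IsMarkovLaw P κ x₀) (hX : GuidingConditions P κ g h t₀ A) :
    1 ≤ ENNReal.ofReal (g 0 x₀ / h 0 x₀) *
      ∫⁻ w, ENNReal.ofReal (psiT κ g w) ∂(inducedMeasure P κ g) := by
  have hle := fun t => (pathFiltration T E).le t
  have hg0 : 0 < g 0 x₀ := hX.g_mem.pos 0 (startTime T).2 _
  have hh0 : 0 < h 0 x₀ := hX.h_mem.pos 0 (startTime T).2 _
  have hh0' : ENNReal.ofReal (h 0 x₀) ≠ 0 := by simpa using hh0
  have := hX.isInducedBy_g.1
  obtain ⟨u, htu, hu⟩ := exists_seq_tendsto_end t₀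
  obtain ⟨l, hl, hl1⟩ := hX.fraction
  have hψm : ∀ k n, Measurable ((A k (u n)).indicator fun w =>
      ENNReal.ofReal (psi κ g (u n) w)) := fun k n =>
    (((hX.g_mem.measurable_psi (u n)).ennreal_ofReal).mono (hle _) le_rfl).indicator
      (hle _ _ (hX.events_adapted k _ (htu n)))
  -- the expectations in (c), in terms of `𝔼^g`
  have hfrac : ∀ k n, ENNReal.ofReal
      (∫ w in A k (u n), g (u n) (w (u n)) / h (u n) (w (u n)) ∂(inducedMeasure P κ h))
      ≤ ENNReal.ofReal (g 0 x₀ / h 0 x₀) *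
        ∫⁻ w, (A k (u n)).indicator (fun w => ENNReal.ofReal (psi κ g (u n) w)) w
          ∂(inducedMeasure P κ g) := by
    intro k n
    have hA := hX.events_adapted k _ (htu n)
    have hpos : ∀ w : PathSpace T E, 0 ≤ g (u n) (w (u n)) / h (u n) (w (u n)) := fun w =>
      (div_pos (hX.g_mem.pos _ (u n).2 _) (hX.h_mem.pos _ (u n).2 _)).le
    have hm : Measurable[pathFiltration T E (u n)] fun w : PathSpace T E =>
        g (u n) (w (u n)) / h (u n) (w (u n)) :=
      (hX.g_mem.measurable_eval le_rfl).div (hX.h_mem.measurable_eval le_rfl)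
    have h1 := hX.isInducedBy_h.lintegral_of_harmonic hP hX.h_mem hX.h_harmonic
      (((measurable_const (a := (1 : ℝ≥0∞))).indicator hA).mul hm.ennreal_ofReal)
    simp only [Pi.mul_apply, mul_assoc] at h1
    have h3 : ∀ w : PathSpace T E, ENNReal.ofReal (g (u n) (w (u n)) / h (u n) (w (u n))) *
        ENNReal.ofReal (h (u n) (w (u n))) = ENNReal.ofReal (g (u n) (w (u n))) := fun w => by
      rw [← ENNReal.ofReal_mul (hpos w), div_mul_cancel₀ _ (hX.h_mem.pos _ (u n).2 _).ne']
    simp only [h3] at h1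
    rw [lintegral_indicator_one_mul _ (hle _ _ hA), lintegral_indicator_one_mul _ (hle _ _ hA),
      ← hX.isInducedBy_g.setLIntegral_psi hP hX.g_mem hA] at h1
    rw [integral_eq_lintegral_of_nonneg_ae (ae_of_all _ hpos)
      (hm.mono (hle _) le_rfl).aestronglyMeasurable]
    refine ENNReal.ofReal_toReal_le.trans (le_of_eq ?_)
    rw [lintegral_indicator (hle _ _ hA), ENNReal.ofReal_div_of_pos hh0, div_eq_mul_inv, mul_right_comm, ← h1, mul_comm, ← mul_assoc,
      ENNReal.inv_mul_cancel hh0' ENNReal.ofReal_ne_top, one_mul]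
  have hk : ∀ k, ENNReal.ofReal (l k) ≤ ENNReal.ofReal (g 0 x₀ / h 0 x₀) *
      ∫⁻ w, ENNReal.ofReal (psiT κ g w) ∂(inducedMeasure P κ g) := by
    intro k
    obtain ⟨C, hC⟩ := hX.psi_bounded k
    have hlim := (ENNReal.continuous_ofReal.tendsto _).comp ((hl k).comp hu)
    rw [← hlim.limsup_eq]
    calc _ ≤ limsup (fun n => ENNReal.ofReal (g 0 x₀ / h 0 x₀) *
          ∫⁻ w, (A k (u n)).indicator (fun w => ENNReal.ofReal (psi κ g (u n) w)) w
            ∂(inducedMeasure P κ g)) atTop := limsup_le_limsup (Eventually.of_forall (hfrac k))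
      _ = ENNReal.ofReal (g 0 x₀ / h 0 x₀) * limsup (fun n =>
          ∫⁻ w, (A k (u n)).indicator (fun w => ENNReal.ofReal (psi κ g (u n) w)) w
            ∂(inducedMeasure P κ g)) atTop :=
        ENNReal.limsup_const_mul_of_ne_top ENNReal.ofReal_ne_top
      _ ≤ ENNReal.ofReal (g 0 x₀ / h 0 x₀) * ∫⁻ w, limsup (fun n =>
          (A k (u n)).indicator (fun w => ENNReal.ofReal (psi κ g (u n) w)) w) atTop
            ∂(inducedMeasure P κ g) := by
        gcongr
        refine limsup_lintegral_le (fun _ => ENNReal.ofReal C) (hψm k) (fun n => ?_) (by simp)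
        filter_upwards [hC (u n) (htu n)] with w hw
        by_cases hwA : w ∈ A k (u n)
        · rw [indicator_of_mem hwA] at hw ⊢
          exact ENNReal.ofReal_le_ofReal hw
        · rw [indicator_of_notMem hwA]
          exact zero_le
      _ ≤ _ := by
        refine mul_le_mul' le_rfl (lintegral_mono_ae ?_)
        filter_upwards [hX.psi_integrable] with w hw
        rw [← ((ENNReal.continuous_ofReal.tendsto _).comp (tendsto_psi hw hu)).limsup_eq]
        exact limsup_le_limsup (Eventually.of_forall fun n => indicator_le_self _ _ _)
  have := (ENNReal.continuous_ofReal.tendsto _).comp hl1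
  rw [ENNReal.ofReal_one] at this
  exact le_of_tendsto' this hk

/-- The likelihood ratio of the induced measures is `Ψ_{T,g}`, up to normalization. Fatou's lemma
gives the inequality `≥` on every `ℱ_s`, and the total masses agree. -/
theorem GuidingConditions.inducedMeasure_eq_withDensity (hκ : IsTransitionSemigroup κ)
    (hP : IsMarkovLaw P κ x₀) (hX : GuidingConditions P κ g h t₀ A) :
    inducedMeasure P κ h = (inducedMeasure P κ g).withDensity
      (fun w => ENNReal.ofReal (g 0 x₀ / h 0 x₀ * psiT κ g w)) := by
  have hg0 : 0 < g 0 x₀ := hX.g_mem.pos 0 (startTime T).2 _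
  have hh0 : 0 < h 0 x₀ := hX.h_mem.pos 0 (startTime T).2 _
  have hc : 0 ≤ g 0 x₀ / h 0 x₀ := (div_pos hg0 hh0).le
  have := hX.isInducedBy_h.1
  set ν := (inducedMeasure P κ g).withDensity
    (fun w => ENNReal.ofReal (g 0 x₀ / h 0 x₀ * psiT κ g w)) with hν
  have hνD : ∀ D, MeasurableSet D → ν D = ENNReal.ofReal (g 0 x₀ / h 0 x₀) *
      ∫⁻ w in D, ENNReal.ofReal (psiT κ g w) ∂(inducedMeasure P κ g) := by
    intro D hD
    simp only [hν, withDensity_apply _ hD, ENNReal.ofReal_mul hc]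
    rw [lintegral_const_mul' _ _ ENNReal.ofReal_ne_top]
  have hle : ∀ s, t₀ ≤ s → ∀ D, MeasurableSet[pathFiltration T E s] D →
      ν D ≤ inducedMeasure P κ h D := by
    intro s hs D hD
    obtain ⟨u, hsu, hu⟩ := exists_seq_tendsto_end s
    rw [hνD D ((pathFiltration T E).le s D hD),
      ← (hX.tendsto_lintegral_psi hκ hP hs hD hu hsu).liminf_eq,
      ENNReal.liminf_const_mul_of_ne_top ENNReal.ofReal_ne_top]
    gcongr
    refine le_trans (lintegral_mono_ae ?_) (lintegral_liminf_le' fun n => ?_)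
    · refine ae_restrict_of_ae ?_
      filter_upwards [hX.psi_integrable] with w hw
      exact ((ENNReal.continuous_ofReal.tendsto _).comp (tendsto_psi hw hu)).liminf_eq.ge
    · exact (((hX.g_mem.measurable_psi (u n)).mono
        ((pathFiltration T E).le _) le_rfl).ennreal_ofReal).aemeasurable
  have huniv : ν univ = 1 := by
    refine le_antisymm ((hle t₀ le_rfl univ MeasurableSet.univ).trans (by simp)) ?_
    rw [hνD univ MeasurableSet.univ, Measure.restrict_univ]
    exact hX.one_le_lintegral_psiT hP
  have : IsProbabilityMeasure ν := ⟨huniv⟩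
  refine measure_eq_of_forall_pathFiltration (by simp) t₀ fun s hs D hD => ?_
  have hD' := (pathFiltration T E).le s D hD
  refine le_antisymm ?_ (hle s hs D hD)
  -- the inequality on the complement
  have h1 := hle s hs Dᶜ hD.compl
  rw [prob_compl_eq_one_sub hD', prob_compl_eq_one_sub hD'] at h1
  exact (ENNReal.sub_le_sub_iff_left prob_le_one ENNReal.one_ne_top).1 h1

end Likelihood

/-! ### Invariance of the conditions under homeomorphisms -/

section Invariance

variable {T : ℝ} {E F : Type*} [TopologicalSpace E] [MeasurableSpace E] [BorelSpace E]
  [TopologicalSpace F] [MeasurableSpace F] [BorelSpace F] (φ : E ≃ₜ F) {κ : ℝ≥0 → Kernel E E}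

lemma psiT_mapPath_symm (f : ℝ → E → ℝ) (y : PathSpace T F) :
    psiT (mapTransition φ κ) (pushforwardFun φ f) y = psiT κ f (mapPath φ.symm y) := by
  simp [psiT, spaceTimeGen_mapTransition, pushforwardFun]

variable [Fact (0 < T)] {P : Measure (PathSpace T E)} {g h : ℝ → E → ℝ}
  {t₀ : Set.Ico (0 : ℝ) T} {A : ℕ → Set.Ico (0 : ℝ) T → Set (PathSpace T E)}

theorem GuidingConditions.mapPath [IsFiniteMeasure P] (hX : GuidingConditions P κ g h t₀ A) :
    GuidingConditions (P.map (mapPath φ)) (mapTransition φ κ) (pushforwardFun φ g)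
      (pushforwardFun φ h) t₀ (fun k t => GuidedProcess.mapPath φ.symm ⁻¹' A k t) := by
  have hemb := measurableEmbedding_mapPath (T := T) φ
  have hg := inducedMeasure_eq (hX.isInducedBy_g.mapPath φ)
  have hh := inducedMeasure_eq (hX.isInducedBy_h.mapPath φ)
  have hpre : ∀ k t, GuidedProcess.mapPath φ ⁻¹' (GuidedProcess.mapPath φ.symm ⁻¹' A k t) = A k t :=
    fun k t => by ext w; simp
  have hslice : ∀ (f : ℝ → E → ℝ) (t : ℝ) (x : E), pushforwardFun φ f t (φ x) = f t x :=
    fun f t x => by simp [pushforwardFun]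
  constructor
  case g_mem => exact hX.g_mem.mapPath φ
  case h_mem => exact hX.h_mem.mapPath φ
  case h_harmonic =>
    intro t ht y
    rw [spaceTimeGen_mapTransition, hX.h_harmonic t ht]
  case events_adapted =>
    exact fun k t ht => measurable_mapPath_pathFiltration φ.symm t (hX.events_adapted k t ht)
  case events_mono => exact fun k t ht => preimage_mono (hX.events_mono k t ht)
  case events_anti => exact fun k s t hs hst => preimage_mono (hX.events_anti k s t hs hst)
  case g_integrable =>
    intro t ht
    rw [hemb.integrable_map_iff]
    simpa [Function.comp_def, hslice] using hX.g_integrable t ht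
  case condExp_bounded =>
    intro s hs
    obtain ⟨C, hC⟩ := hX.condExp_bounded s hs
    refine ⟨C, fun t ht => ?_⟩
    rw [hemb.ae_map_iff]
    filter_upwards [hC t ht, condExp_mapPath φ P s fun w => pushforwardFun φ g t (w t)] with w h1 h2
    rw [h2]
    simpa only [mapPath_apply, hslice] using h1
  case condExp_tendsto =>
    intro s hs y
    simp only [condExpAt_mapTransition, hslice]
    exact hX.condExp_tendsto s hs _
  case fraction =>
    obtain ⟨l, hl, hl1⟩ := hX.fraction
    refine ⟨l, fun k => ?_, hl1⟩
    simp only [hh, hemb.setIntegral_map, hpre, mapPath_apply, hslice]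
    exact hl k
  case psi_bounded =>
    intro k
    obtain ⟨C, hC⟩ := hX.psi_bounded k
    refine ⟨C, fun t ht => ?_⟩
    rw [hg, hemb.ae_map_iff]
    filter_upwards [hC t ht] with w hw
    refine le_of_eq_of_le ?_ hw
    by_cases hwA : w ∈ A k t
    · rw [indicator_of_mem hwA, indicator_of_mem (by simpa using hwA), psi_mapPath]
    · rw [indicator_of_notMem hwA, indicator_of_notMem (by simpa using hwA)]
  case psi_integrable =>
    rw [hg, hemb.ae_map_iff]
    simpa [spaceTimeGen_mapTransition, hslice] using hX.psi_integrable
  case full =>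
    rw [hg, hemb.map_apply]
    simp only [preimage_iInter, preimage_iUnion, hpre]
    exact hX.full

end Invariance

/-! ### Equivalence of the induced measures -/

section Equivalence

variable {T : ℝ} {E : Type*} [TopologicalSpace E] [MeasurableSpace E] [Fact (0 < T)]
  {P : Measure (PathSpace T E)} {κ : ℝ≥0 → Kernel E E} {x₀ : E} {g h : ℝ → E → ℝ}
  {t₀ : Set.Ico (0 : ℝ) T} {A : ℕ → Set.Ico (0 : ℝ) T → Set (PathSpace T E)}

theorem GuidingConditions.equivalent_and_rnDeriv (hκ : IsTransitionSemigroup κ)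
    (hP : IsMarkovLaw P κ x₀) (hX : GuidingConditions P κ g h t₀ A) :
    inducedMeasure P κ h ≪ inducedMeasure P κ g ∧ inducedMeasure P κ g ≪ inducedMeasure P κ h ∧
    (inducedMeasure P κ h).rnDeriv (inducedMeasure P κ g) =ᵐ[inducedMeasure P κ g]
      fun w => ENNReal.ofReal (g 0 x₀ / h 0 x₀ * psiT κ g w) := by
  have := hX.isInducedBy_g.1
  have hm : AEMeasurable (fun w => ENNReal.ofReal (g 0 x₀ / h 0 x₀ * psiT κ g w))
      (inducedMeasure P κ g) := (hX.aemeasurable_psiT.const_mul _).ennreal_ofReal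
  rw [hX.inducedMeasure_eq_withDensity hκ hP]
  refine ⟨withDensity_absolutelyContinuous _ _, withDensity_absolutelyContinuous' hm
    (ae_of_all _ fun w => ?_), Measure.rnDeriv_withDensity₀ _ hm⟩
  have h1 : 0 < g 0 x₀ / h 0 x₀ := div_pos (hX.g_mem.pos 0 (startTime T).2 _)
    (hX.h_mem.pos 0 (startTime T).2 _)
  have h2 : 0 < psiT κ g w := Real.exp_pos _
  simpa using mul_pos h1 h2

end Equivalence

/-! ### Solutions of the backward heat equation -/

section HeatEquation

variable {d : ℕ} {M : Type*} [TopologicalSpace M] [ChartedSpace (EuclideanSpace ℝ (Fin d)) M]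

lemma vecDeriv_log (V : (x : M) → TangentSpace (𝓡 d) x) {f : M → ℝ} {x : M}
    (hf : MDifferentiableAt (𝓡 d) 𝓘(ℝ, ℝ) f x) (hx : f x ≠ 0) :
    vecDeriv V (fun z => Real.log (f z)) x = vecDeriv V f x / f x := by
  have hlog : HasMFDerivAt 𝓘(ℝ, ℝ) 𝓘(ℝ, ℝ) Real.log (f x) _ :=
    (Real.hasDerivAt_log hx).hasFDerivAt.hasMFDerivAt
  have h := (hlog.comp x hf.hasMFDerivAt).mfderiv
  have h' := congrArg (fun L => L (V x)) h
  refine h'.trans ?_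
  change vecDeriv V f x • (f x)⁻¹ = _
  rw [smul_eq_mul, div_eq_mul_inv]

variable [IsManifold (𝓡 d) ∞ M] [MeasurableSpace M]

lemma IsBrownianWithDrift.generator_apply {G : Metric d M} {V : (x : M) → TangentSpace (𝓡 d) x}
    {κ : ℝ≥0 → Kernel M M} (hκ : IsBrownianWithDrift G V κ) {f : M → ℝ}
    (hf : ContMDiff (𝓡 d) 𝓘(ℝ, ℝ) 2 f) (x : M) :
    generator κ f x = vecDeriv V f x + laplaceBeltrami G f x / 2 :=
  ((hκ.generator_eq f hf).tendsto_at x).limUnder_eq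

/-- For a solution of the backward heat equation only the drift contributes to `𝒜g / g`. -/
lemma IsBrownianWithDrift.spaceTimeGen_div {G : Metric d M} {V : (x : M) → TangentSpace (𝓡 d) x}
    {κ : ℝ≥0 → Kernel M M} (hκ : IsBrownianWithDrift G V κ) {T t : ℝ} {g : ℝ → M → ℝ}
    (hg : ContMDiff (𝓡 d) 𝓘(ℝ, ℝ) 2 (g t)) {x : M} (hx : g t x ≠ 0)
    (heat : timeDeriv T g t x + laplaceBeltrami G (g t) x / 2 = 0) :
    spaceTimeGen T κ g t x / g t x = vecDeriv V (fun z => Real.log (g t z)) x := by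
  rw [vecDeriv_log V ((hg x).mdifferentiableAt (by norm_num)) hx, spaceTimeGen,
    hκ.generator_apply hg]
  congr 1
  linarith

end HeatEquation

end GuidedProcess

end

theorem theorem4p2 {d : ℕ}
    {M : Type*} [TopologicalSpace M] [ChartedSpace (EuclideanSpace ℝ (Fin d)) M]
    [IsManifold (𝓡 d) ∞ M] [T2Space M] [CompactSpace M] [MeasurableSpace M] [BorelSpace M]
    {N : Type*} [TopologicalSpace N] [ChartedSpace (EuclideanSpace ℝ (Fin d)) N]
    [IsManifold (𝓡 d) ∞ N] [MeasurableSpace N] [BorelSpace N]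
    (Φ : Diffeomorph (𝓡 d) (𝓡 d) M N ∞)
    (G : GuidedProcess.Metric d M) (V : (x : M) → TangentSpace (𝓡 d) x)
    (hV : ContMDiff (𝓡 d) (𝓡 d).tangent ∞
      (fun x => (⟨x, V x⟩ : TangentBundle (𝓡 d) M)))
    (T : ℝ) [Fact (0 < T)]
    -- the law `P` of the Brownian motion `X` with drift `V` started at `x₀`
    (κ : ℝ≥0 → Kernel M M) (hκ : IsBrownianWithDrift G V κ)
    (x₀ : M) (P : Measure (PathSpace T M)) (hP : IsMarkovLaw P κ x₀)
    (g h : ℝ → M → ℝ) (t₀ : Set.Ico (0 : ℝ) T)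
    (A : ℕ → Set.Ico (0 : ℝ) T → Set (PathSpace T M))
    (hX : GuidingConditions P κ g h t₀ A) :
    -- transition function and law of `Y = Φ(X)`, the functions `Φ_* g`, `Φ_* h`, and the measures
    -- that they induce
    let φ : M ≃ₜ N := Φ.toHomeomorph
    let κY : ℝ≥0 → Kernel N N := mapTransition φ κ
    let Q : Measure (PathSpace T N) := P.map (mapPath φ)
    let gY : ℝ → N → ℝ := pushforwardFun φ g
    let hY : ℝ → N → ℝ := pushforwardFun φ h
    let y₀ : N := Φ x₀
    let Qg : Measure (PathSpace T N) := inducedMeasure Q κY gY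
    let Qh : Measure (PathSpace T N) := inducedMeasure Q κY hY
    IsTransitionSemigroup κY ∧ IsMarkovLaw Q κY y₀ ∧
    -- the conditions hold for `Y`, with the same events, seen on the path space of `N`
    GuidingConditions Q κY gY hY t₀ (fun k t => mapPath φ.symm ⁻¹' A k t) ∧
    -- equivalence of the induced laws, and the likelihood ratio
    Qh ≪ Qg ∧ Qg ≪ Qh ∧
    Qh.rnDeriv Qg =ᵐ[Qg]
      (fun y => ENNReal.ofReal (gY 0 y₀ / hY 0 y₀ * psiT κ g (mapPath φ.symm y))) ∧
    -- if `g` solves the backward heat equation, then `𝒜g / g = V (log g)` in `Ψ_{T,g}`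
    ((∀ t ∈ Set.Ico 0 T, ContMDiff (𝓡 d) 𝓘(ℝ, ℝ) 2 (g t) ∧
        ∀ x, timeDeriv T g t x + laplaceBeltrami G (g t) x / 2 = 0) →
      (∀ t ∈ Set.Ico 0 T, ∀ x, spaceTimeGen T κ g t x / g t x =
        vecDeriv V (fun z => Real.log (g t z)) x) ∧
      Qh.rnDeriv Qg =ᵐ[Qg] (fun y => ENNReal.ofReal (gY 0 y₀ / hY 0 y₀ *
        Real.exp (∫ s, vecDeriv V (fun z => Real.log (g (s : ℝ) z)) (φ.symm (y s))
          ∂timeMeasure T)))) := by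
  intro φ κY Q gY hY y₀ Qg Qh
  have := hP.isProbability
  have hκY : IsTransitionSemigroup κY := hκ.semigroup.mapTransition φ
  have hQ : IsMarkovLaw Q κY y₀ := hP.mapPath φ
  have hC : GuidingConditions Q κY gY hY t₀ (fun k t => mapPath φ.symm ⁻¹' A k t) := hX.mapPath φ
  obtain ⟨h1, h2, h3⟩ := hC.equivalent_and_rnDeriv hκY hQ
  have h4 : Qh.rnDeriv Qg =ᵐ[Qg]
      (fun y => ENNReal.ofReal (gY 0 y₀ / hY 0 y₀ * psiT κ g (mapPath φ.symm y))) := by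
    filter_upwards [h3] with y hy
    rw [hy, psiT_mapPath_symm]
  refine ⟨hκY, hQ, hC, h1, h2, h4, fun heat => ?_⟩
  have hgen : ∀ t ∈ Set.Ico 0 T, ∀ x, spaceTimeGen T κ g t x / g t x =
      vecDeriv V (fun z => Real.log (g t z)) x := fun t ht x =>
    hκ.spaceTimeGen_div (heat t ht).1 (hX.g_mem.pos t ht x).ne' ((heat t ht).2 x)
  refine ⟨hgen, ?_⟩
  filter_upwards [h4] with y hy
  rw [hy, psiT, integral_congr_ae (ae_of_all _ fun s : Set.Ico (0 : ℝ) T => hgen s s.2 _)]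
  rfl
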